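/- For integers $s\ge 2$ and $t\ge 1$ put $$\zeta(s)=\sum_{n\ge 1}\frac1{n^s},\qquad \lambda(s)=\sum_{n\ge 1}\frac1{(2n-1)^s},\qquad \sigma(s,t)=\sum_{n\ge 1}\Big(1+\frac1{3^t}+\cdots+\frac1{(2n-1)^t}\Big)\frac1{n^s}.$$ Then for every integer $a\ge 2$ the series $\sigma(2a-1,2)$ converges and $$\sigma(2a-1,2)=-a\,2^{2a-1}\lambda(2a+1)+\frac{2^{2a-1}(2a+1)}{3}\,\lambda(2)\lambda(2a-1)+\sum_{j=1}^{a-2}j\,2^{2j}\lambda(2j+1)\,\zeta(2a-2j),$$ where the last sum is empty (equal to $0$) for $a=2$. -/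

import Mathlib

noncomputable section

/-- `ζ(s) = ∑_{n ≥ 1} 1 / n ^ s` as a real series, for integers `s ≥ 2`. -/
def zetaSeries (s : ℕ) : ℝ := ∑' n : ℕ, 1 / ((n : ℝ) + 1) ^ s

/-- `λ(s) = ∑_{n ≥ 1} 1 / (2 n - 1) ^ s`, for integers `s ≥ 2`;
the index is shifted by one, so that `2 (n + 1) - 1 = 2 n + 1`. -/
def lambdaSeries (s : ℕ) : ℝ := ∑' n : ℕ, 1 / (2 * (n : ℝ) + 1) ^ s

/-- `S_n^{(t)} = ∑_{k = 1}^{n} 1 / (2 k - 1) ^ t`. -/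
def semiHarmonic (t n : ℕ) : ℝ := ∑ k ∈ Finset.Icc 1 n, 1 / (2 * (k : ℝ) - 1) ^ t

/-- The term of index `n + 1` of the series `σ(s, t)`, namely `S_{n+1}^{(t)} / (n + 1) ^ s`. -/
def sigmaTerm (s t n : ℕ) : ℝ := semiHarmonic t (n + 1) / ((n : ℝ) + 1) ^ s

/-- `σ(s, t) = ∑_{n ≥ 1} S_n^{(t)} / n ^ s`. -/
def sigmaSum (s t : ℕ) : ℝ := ∑' n : ℕ, sigmaTerm s t n

end

open Finset

/-! Let p run over odd and q over even positive integers. With k = a - 1, sum ∑ j p^(-2j-1)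
q^(-2(k+1-j)) over all p, q: termwise this gives the products λ·ζ. By
`sum_weighted_partial_fractions` it also splits into three kernels: 1/(q²-p²) and q²/(q²-p²)²,
summed over q, give 1/(2p²) and λ(2)/2; p/(q²-p²)², summed over p, gives the partial sums of σ.
Comparing yields `sigmaSum_two_eq_convolution`; its j = k term contains ζ(2) = (4/3)λ(2) and joins
the λ(2)λ(2a-1) term. -/

lemma HasSum.congr_terms {f g : ℕ → ℝ} {c : ℝ} (hf : HasSum f c) (h : ∀ n, g n = f n) :
    HasSum g c :=
  (funext h : g = f) ▸ hf

lemma even_sub_odd_ne_zero (M N : ℕ) : 2 * (N : ℝ) + 2 - (2 * M + 1) ≠ 0 := by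
  intro h
  have h' : (2 * N + 2 : ℕ) = 2 * M + 1 := by
    have : (2 * (N : ℝ) + 2) = 2 * M + 1 := by linarith
    exact_mod_cast this
  omega

lemma sq_even_sub_sq_odd_ne_zero (M N : ℕ) :
    (2 * (N : ℝ) + 2) ^ 2 - (2 * M + 1) ^ 2 ≠ 0 := by
  rw [sq_sub_sq]
  exact mul_ne_zero (by positivity) (even_sub_odd_ne_zero M N)

lemma summable_zetaSeries {s : ℕ} (hs : 2 ≤ s) :
    Summable fun n : ℕ => 1 / ((n : ℝ) + 1) ^ s := by
  have h := (summable_nat_add_iff 1).2 (Real.summable_one_div_nat_pow.2 (by omega : 1 < s))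
  simpa using h

lemma summable_lambdaSeries {s : ℕ} (hs : 2 ≤ s) :
    Summable fun n : ℕ => 1 / (2 * (n : ℝ) + 1) ^ s := by
  refine (summable_zetaSeries hs).of_nonneg_of_le (fun n => by positivity) fun n => ?_
  have : (0 : ℝ) ≤ n := n.cast_nonneg
  gcongr
  linarith

lemma hasSum_lambdaSeries {s : ℕ} (hs : 2 ≤ s) :
    HasSum (fun n : ℕ => 1 / (2 * (n : ℝ) + 1) ^ s) (lambdaSeries s) :=
  (summable_lambdaSeries hs).hasSum

lemma hasSum_even_zetaSeries {s : ℕ} (hs : 2 ≤ s) :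
    HasSum (fun n : ℕ => 1 / (2 * (n : ℝ) + 2) ^ s) (zetaSeries s / 2 ^ s) := by
  have h := (summable_zetaSeries hs).hasSum.div_const (2 ^ s)
  convert! h using 2 with n
  rw [div_div, ← mul_pow]
  ring_nf

lemma zetaSeries_two : zetaSeries 2 = 4 / 3 * lambdaSeries 2 := by
  have h : HasSum (fun n : ℕ => 1 / ((n : ℝ) + 1) ^ 2) (lambdaSeries 2 + zetaSeries 2 / 2 ^ 2) := by
    refine HasSum.even_add_odd ?_ ?_
    · simpa using hasSum_lambdaSeries le_rfl
    · convert! hasSum_even_zetaSeries le_rfl using 3 with n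
      push_cast
      ring
  have h' : zetaSeries 2 = _ := h.tsum_eq
  linarith

/-- Partial fractions for a weighted geometric sum. -/
lemma sum_weighted_partial_fractions {p q : ℝ} (hp : p ≠ 0) (hq : q ≠ 0)
    (h : q ^ 2 - p ^ 2 ≠ 0) (k : ℕ) :
    ∑ j ∈ range (k + 1), (j : ℝ) * (1 / p ^ (2 * j + 1) * (1 / q ^ (2 * (k + 1 - j)))) =
      (k + 1) / p ^ (2 * k + 1) * (1 / (q ^ 2 - p ^ 2))
      - 1 / p ^ (2 * k + 1) * (q ^ 2 / (q ^ 2 - p ^ 2) ^ 2)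
      + 1 / q ^ (2 * k) * (p / (q ^ 2 - p ^ 2) ^ 2) := by
  induction k with
  | zero => simp; field_simp; ring
  | succ k ih =>
    have hstep : ∑ j ∈ range (k + 1),
        (j : ℝ) * (1 / p ^ (2 * j + 1) * (1 / q ^ (2 * (k + 1 + 1 - j)))) =
        (∑ j ∈ range (k + 1), (j : ℝ) * (1 / p ^ (2 * j + 1) * (1 / q ^ (2 * (k + 1 - j)))))
          * (1 / q ^ 2) := by
      rw [sum_mul]
      refine sum_congr rfl fun j hj => ?_
      have hj' : j ≤ k := by simpa [Nat.lt_succ_iff] using hj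
      rw [show 2 * (k + 1 + 1 - j) = 2 * (k + 1 - j) + 2 by omega, pow_add q]
      ring
    rw [sum_range_succ, hstep, ih, show 2 * (k + 1 + 1 - (k + 1)) = 2 by omega,
      show 2 * (k + 1) + 1 = 2 * k + 1 + 2 by ring, show 2 * (k + 1) = 2 * k + 2 by ring,
      pow_add p, pow_add q]
    push_cast
    field_simp
    ring

/-! ### Sums over even q for fixed odd p -/

lemma cot_pi_mul_half_odd (M : ℕ) : Complex.cot (Real.pi * ((2 * (M : ℂ) + 1) / 2)) = 0 := by
  rw [Complex.cot, div_eq_zero_iff]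
  left
  rw [Complex.cos_eq_zero_iff]
  exact ⟨M, by push_cast; ring⟩

lemma half_odd_mem_integerComplement (M : ℕ) :
    (2 * (M : ℂ) + 1) / 2 ∈ Complex.integerComplement := by
  rintro ⟨k, hk⟩
  have h : ((2 * k : ℤ) : ℂ) = ((2 * M + 1 : ℤ) : ℂ) := by
    push_cast
    rw [hk]
    ring
  have := Int.cast_injective h
  omega

/-- The Mittag-Leffler expansion of π cot πx at x = p/2, where the cotangent vanishes, leaves only
-1/x. -/
lemma hasSum_inv_sq_even_sub_sq_odd (M : ℕ) :
    HasSum (fun N : ℕ => 1 / ((2 * (N : ℝ) + 2) ^ 2 - (2 * M + 1) ^ 2))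
      (1 / (2 * (2 * (M : ℝ) + 1) ^ 2)) := by
  have hx := half_odd_mem_integerComplement M
  have h := (summable_cotTerm hx).hasSum
  have hrep := cot_series_rep' hx
  rw [cot_pi_mul_half_odd] at hrep
  change _ = ∑' n, cotTerm _ n at hrep
  rw [← hrep] at h
  rw [← Complex.hasSum_ofReal]
  have hp : 2 * (M : ℂ) + 1 ≠ 0 := by exact_mod_cast (2 * M).succ_ne_zero
  convert! h.mul_left (-1 / (4 * (2 * (M : ℂ) + 1))) using 1
  · ext N
    have hd : (2 * (N : ℂ) + 2) ^ 2 - (2 * M + 1) ^ 2 ≠ 0 := by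
      exact_mod_cast sq_even_sub_sq_odd_ne_zero M N
    rw [cotTerm_identity hx,
      show ((2 * (M : ℂ) + 1) / 2 + (N + 1)) * ((2 * (M : ℂ) + 1) / 2 - (N + 1)) = -((2 * (N : ℂ) + 2) ^ 2 - (2 * M + 1) ^ 2) / 4 by ring]
    push_cast
    generalize (2 * (N : ℂ) + 2) ^ 2 - (2 * M + 1) ^ 2 = d at *
    field_simp
  · push_cast
    field_simp
    ring

lemma hasSum_int_inv_sq_odd :
    HasSum (fun k : ℤ => 1 / (2 * (k : ℝ) + 1) ^ 2) (2 * lambdaSeries 2) := by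
  rw [two_mul]
  refine HasSum.of_nat_of_neg_add_one ?_ ?_
  · simpa using hasSum_lambdaSeries le_rfl
  · convert! hasSum_lambdaSeries le_rfl using 2 with n
    push_cast
    ring

/-- Here 4q²/(q²-p²)² = 1/(q-p)² + 1/(q+p)² + 2/(q²-p²). The two squares run through all odd
integers except p, and the last term restores the missing 1/p². -/
lemma hasSum_sq_even_div_sq (M : ℕ) :
    HasSum (fun N : ℕ => (2 * (N : ℝ) + 2) ^ 2 / ((2 * (N : ℝ) + 2) ^ 2 - (2 * M + 1) ^ 2) ^ 2)
      (lambdaSeries 2 / 2) := by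
  have h := (Equiv.addRight (M : ℤ)).hasSum_iff.2 hasSum_int_inv_sq_odd
  have h2 := (hasSum_nat_add_iff' 1).2 h.nat_add_neg
  convert! (h2.add ((hasSum_inv_sq_even_sub_sq_odd M).mul_left 2)).div_const 4 using 1
  · ext N
    have h1 := even_sub_odd_ne_zero M N
    have h3 : (2 * (N : ℝ) + 2 + (2 * M + 1)) ≠ 0 := by positivity
    simp only [Function.comp, Equiv.coe_addRight]
    push_cast
    rw [show 2 * ((N : ℝ) + 1 + M) + 1 = 2 * (N : ℝ) + 2 + (2 * M + 1) by ring,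
      show 2 * (-((N : ℝ) + 1) + M) + 1 = -(2 * (N : ℝ) + 2 - (2 * M + 1)) by ring,
      sq_sub_sq (2 * (N : ℝ) + 2)]
    generalize 2 * (N : ℝ) + 2 = q at *
    generalize 2 * (M : ℝ) + 1 = p at *
    field_simp
    ring
  · simp
    field_simp
    ring

/-! ### Sums over odd p for fixed even q -/

lemma semiHarmonic_succ (t n : ℕ) :
    semiHarmonic t (n + 1) = semiHarmonic t n + 1 / (2 * (n : ℝ) + 1) ^ t := by
  rw [semiHarmonic, semiHarmonic, sum_Icc_succ_top (by omega)]
  push_cast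
  ring_nf

lemma hasSum_inv_sq_odd_add (N : ℕ) :
    HasSum (fun M : ℕ => 1 / (2 * (M : ℝ) + 1 + 2 * N) ^ 2) (lambdaSeries 2 - semiHarmonic 2 N) := by
  induction N with
  | zero => simpa [semiHarmonic] using hasSum_lambdaSeries le_rfl
  | succ N ih =>
    convert! (hasSum_nat_add_iff' 1).2 ih using 1
    · ext M
      push_cast
      ring
    · rw [semiHarmonic_succ]
      simp
      ring

lemma hasSum_inv_sq_odd_sub (N : ℕ) :
    HasSum (fun M : ℕ => 1 / (2 * (M : ℝ) + 1 - 2 * N) ^ 2) (lambdaSeries 2 + semiHarmonic 2 N) := by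
  induction N with
  | zero => simpa [semiHarmonic] using hasSum_lambdaSeries le_rfl
  | succ N ih =>
    rw [← hasSum_nat_add_iff' 1]
    convert! ih using 1
    · ext M
      push_cast
      ring
    · rw [semiHarmonic_succ]
      simp
      ring

/-- Since 4pq/(q²-p²)² = 1/(p-q)² - 1/(p+q)², the two shifted tails of λ(2) differ by twice the
partial sum. -/
lemma hasSum_odd_div_sq (N : ℕ) :
    HasSum (fun M : ℕ => (2 * (M : ℝ) + 1) / ((2 * (N : ℝ) + 2) ^ 2 - (2 * M + 1) ^ 2) ^ 2)
      (semiHarmonic 2 (N + 1) / (2 * (2 * (N : ℝ) + 2))) := by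
  convert! ((hasSum_inv_sq_odd_sub (N + 1)).sub (hasSum_inv_sq_odd_add (N + 1))).mul_left
    (1 / (4 * (2 * (N : ℝ) + 2))) using 1
  · ext M
    have h1 := even_sub_odd_ne_zero M N
    have h3 : (2 * (N : ℝ) + 2 + (2 * M + 1)) ≠ 0 := by positivity
    have h4 : 2 * (N : ℝ) + 2 ≠ 0 := by positivity
    push_cast
    rw [show 2 * (M : ℝ) + 1 - 2 * (N + 1) = -(2 * (N : ℝ) + 2 - (2 * M + 1)) by ring,
      show 2 * (M : ℝ) + 1 + 2 * (N + 1) = 2 * (N : ℝ) + 2 + (2 * M + 1) by ring,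
      sq_sub_sq (2 * (N : ℝ) + 2)]
    generalize 2 * (N : ℝ) + 2 = q at *
    generalize 2 * (M : ℝ) + 1 = p at *
    field_simp
    ring
  · field_simp
    ring

lemma semiHarmonic_nonneg (n : ℕ) : 0 ≤ semiHarmonic 2 n :=
  sum_nonneg fun _ _ => by positivity

lemma semiHarmonic_two_le (n : ℕ) : semiHarmonic 2 n ≤ lambdaSeries 2 :=
  sub_nonneg.1 ((hasSum_inv_sq_odd_add n).nonneg fun _ => by positivity)

lemma summable_sigmaTerm_two {s : ℕ} (hs : 2 ≤ s) : Summable (sigmaTerm s 2) := by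
  refine ((summable_zetaSeries hs).mul_left (lambdaSeries 2)).of_nonneg_of_le (fun n => ?_)
    fun n => ?_
  · exact div_nonneg (semiHarmonic_nonneg _) (by positivity)
  · rw [mul_one_div]
    exact div_le_div_of_nonneg_right (semiHarmonic_two_le _) (by positivity)

/-- A nonnegative double series is summed by summing rows first. -/
lemma hasSum_prod_of_nonneg {f : ℕ × ℕ → ℝ} {g : ℕ → ℝ} {c : ℝ} (hf : ∀ x, 0 ≤ f x)
    (hrow : ∀ m, HasSum (fun n => f (m, n)) (g m)) (hg : HasSum g c) : HasSum f c := by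
  have hs : Summable f := (summable_prod_of_nonneg hf).2
    ⟨fun m => (hrow m).summable, by simpa only [(hrow _).tsum_eq] using hg.summable⟩
  exact (hs.hasSum.prod_fiberwise hrow).unique hg ▸ hs.hasSum

lemma hasSum_row_part {k : ℕ} (hk : 1 ≤ k) :
    HasSum (fun x : ℕ × ℕ => 1 / (2 * (x.1 : ℝ) + 1) ^ (2 * k + 1) *
      ((2 * (x.2 : ℝ) + 2) ^ 2 / ((2 * (x.2 : ℝ) + 2) ^ 2 - (2 * x.1 + 1) ^ 2) ^ 2))
      (lambdaSeries (2 * k + 1) * (lambdaSeries 2 / 2)) := by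
  have h := (hasSum_lambdaSeries (s := 2 * k + 1) (by omega)).mul_right (lambdaSeries 2 / 2)
  refine hasSum_prod_of_nonneg (fun x => ?_) (fun M => ?_) h
  · positivity
  · exact (hasSum_sq_even_div_sq M).mul_left _

lemma hasSum_column_part {k : ℕ} (hk : 1 ≤ k) :
    HasSum (fun x : ℕ × ℕ => 1 / (2 * (x.2 : ℝ) + 2) ^ (2 * k) *
      ((2 * (x.1 : ℝ) + 1) / ((2 * (x.2 : ℝ) + 2) ^ 2 - (2 * x.1 + 1) ^ 2) ^ 2))
      (sigmaSum (2 * k + 1) 2 / 2 ^ (2 * k + 2)) := by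
  rw [← (Equiv.prodComm ℕ ℕ).hasSum_iff]
  have h : HasSum _ (sigmaSum (2 * k + 1) 2 / 2 ^ (2 * k + 2)) :=
    (summable_sigmaTerm_two (s := 2 * k + 1) (by omega)).hasSum.div_const _
  refine hasSum_prod_of_nonneg (fun x => ?_) (fun N => ?_) h
  · simp only [Function.comp]
    positivity
  convert! (hasSum_odd_div_sq N).mul_left (1 / (2 * (N : ℝ) + 2) ^ (2 * k)) using 1
  rw [sigmaTerm, show 2 * (N : ℝ) + 2 = 2 * (N + 1) by ring, mul_pow]
  field_simp
  ring

lemma hasSum_convolution (k : ℕ) :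
    HasSum (fun x : ℕ × ℕ => ∑ j ∈ range (k + 1), (j : ℝ) *
      (1 / (2 * (x.1 : ℝ) + 1) ^ (2 * j + 1) * (1 / (2 * (x.2 : ℝ) + 2) ^ (2 * (k + 1 - j)))))
      (∑ j ∈ range (k + 1), (j : ℝ) *
        (lambdaSeries (2 * j + 1) * (zetaSeries (2 * (k + 1 - j)) / 2 ^ (2 * (k + 1 - j))))) := by
  refine hasSum_sum fun j hj => ?_
  have hj' : j < k + 1 := mem_range.1 hj
  rcases j.eq_zero_or_pos with rfl | hpos
  · simp
  have h1 := hasSum_lambdaSeries (s := 2 * j + 1) (by omega)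
  have h2 := hasSum_even_zetaSeries (s := 2 * (k + 1 - j)) (by omega)
  exact (h1.mul h2 (h1.summable.mul_of_nonneg h2.summable (fun _ => by positivity)
    fun _ => by positivity)).mul_left _

lemma sigmaSum_two_eq_convolution {k : ℕ} (hk : 1 ≤ k) :
    sigmaSum (2 * k + 1) 2 / 2 ^ (2 * k + 2) =
      lambdaSeries (2 * k + 1) * (lambdaSeries 2 / 2)
      - (k + 1) / 2 * lambdaSeries (2 * k + 3)
      + ∑ j ∈ range (k + 1), (j : ℝ) *
        (lambdaSeries (2 * j + 1) * (zetaSeries (2 * (k + 1 - j)) / 2 ^ (2 * (k + 1 - j)))) := by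
  -- The kernel 1/(q²-p²) changes sign, so its double summability is inherited from three
  -- nonnegative families; only then is it summed by rows.
  have h := ((hasSum_convolution k).add (hasSum_row_part hk)).sub (hasSum_column_part hk)
  have hrow (M : ℕ) := (hasSum_inv_sq_even_sub_sq_odd M).mul_left
    (((k : ℝ) + 1) / (2 * (M : ℝ) + 1) ^ (2 * k + 1))
  have h1 := h.prod_fiberwise fun M => (hrow M).congr_terms fun N => ?_
  have h2 := (hasSum_lambdaSeries (s := 2 * k + 3) (by omega)).mul_left (((k : ℝ) + 1) / 2)
  have h3 := h1.unique (h2.congr_terms fun M => ?_)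
  · linarith
  · rw [show 2 * k + 3 = 2 * k + 1 + 2 by ring]
    field_simp
    ring
  · dsimp only
    rw [sum_weighted_partial_fractions (by positivity) (by positivity)
      (sq_even_sub_sq_odd_ne_zero M N)]
    ring

theorem mainTheorem7 (a : ℕ) (ha : 2 ≤ a) :
    Summable (sigmaTerm (2 * a - 1) 2) ∧
    sigmaSum (2 * a - 1) 2 =
      -((a : ℝ) * 2 ^ (2 * a - 1) * lambdaSeries (2 * a + 1))
      + (2 : ℝ) ^ (2 * a - 1) * (2 * (a : ℝ) + 1) / 3 * lambdaSeries 2 * lambdaSeries (2 * a - 1)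
      + ∑ j ∈ Finset.Icc 1 (a - 2),
          (j : ℝ) * 2 ^ (2 * j) * lambdaSeries (2 * j + 1) * zetaSeries (2 * a - 2 * j) := by
  obtain ⟨k, rfl⟩ : ∃ k, a = k + 2 := ⟨a - 2, by omega⟩
  refine ⟨summable_sigmaTerm_two (by omega), ?_⟩
  have h := sigmaSum_two_eq_convolution (k := k + 1) (by omega)
  rw [sum_range_succ, show 2 * (k + 1 + 1 - (k + 1)) = 2 by omega, zetaSeries_two,
    div_eq_iff (by positivity)] at h
  have hsum : (∑ j ∈ range (k + 1), (j : ℝ) * (lambdaSeries (2 * j + 1) *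
      (zetaSeries (2 * (k + 1 + 1 - j)) / 2 ^ (2 * (k + 1 + 1 - j))))) * 2 ^ (2 * (k + 1) + 2) =
      ∑ j ∈ Icc 1 k,
        (j : ℝ) * 2 ^ (2 * j) * lambdaSeries (2 * j + 1) * zetaSeries (2 * (k + 2) - 2 * j) := by
    rw [sum_range_eq_add_Ico _ (by omega), Nat.cast_zero, zero_mul, zero_add, sum_mul]
    refine sum_congr rfl fun j hj => ?_
    have hj' : j ≤ k := (mem_Icc.1 hj).2
    rw [show 2 * (k + 2) - 2 * j = 2 * (k + 1 + 1 - j) by omega,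
      show 2 * (k + 1) + 2 = 2 * j + 2 * (k + 1 + 1 - j) by omega, pow_add]
    field_simp
  rw [show 2 * (k + 2) - 1 = 2 * (k + 1) + 1 by omega, h, show k + 2 - 2 = k by omega, ← hsum,
    show 2 * (k + 2) + 1 = 2 * (k + 1) + 3 by ring]
  push_cast
  ring
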